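/- Let $G$ be a (finite-dimensional real) Lie group with Lie algebra $\mathfrak g=T_eG$, let $r\in\Lambda^2\mathfrak g$ and let $n:\mathfrak g\to\mathfrak g$ be a linear endomorphism. Let $\overrightarrow{r}$ and $\overrightarrow{n}$ denote the right-invariant bivector field and the right-invariant $(1,1)$-tensor field on $G$ given by $\overrightarrow{r}(g)=(\Lambda^2 T_eR_g)(r)$ and $\overrightarrow{n}(g)=T_eR_g\circ n\circ T_gR_{g^{-1}}$, where $R_g(h)=hg$. For a $2$-vector (or bivector field) $P$ let $P^\sharp$ be the map determined by $\langle\alpha,P^\sharp\beta\rangle=P(\alpha,\beta)$. Suppose that $(\Pi,N)=(\overrightarrow{r},\overrightarrow{n})$ is a Poisson–Nijenhuis structure on $G$, that is: - $[\Pi,\Pi]=0$ (Schouten–Nijenhuis bracket); - $[NX,NY]-N[NX,Y]-N[X,NY]+N^2[X,Y]=0$ for all $X,Y\in\mathfrak X(G)$; - $N\circ\Pi^\sharp=\Pi^\sharp\circ N^t$; - for all $\alpha,\beta\in\Omega^1(G)$, $$\mathcal L_{\Pi^\sharp\alpha}(N^t\beta)-\mathcal L_{\Pi^\sharp\beta}(N^t\alpha)+N^t\mathcal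 L_{\Pi^\sharp\beta}\alpha-N^t\mathcal L_{\Pi^\sharp\alpha}\beta+d\langle\alpha,N\Pi^\sharp\beta\rangle-N^td\langle\alpha,\Pi^\sharp\beta\rangle=0 .$$ Then for every integer $k\ge 0$: (i) There is exactly one $2$-vector $r_k\in\Lambda^2\mathfrak g$ with $r_k^\sharp=n^k\circ r^\sharp$, and it is a solution of the classical Yang–Baxter equation on $\mathfrak g$, i.e. $[\![r_k,r_k]\!]=0$ for the algebraic Schouten bracket of $\mathfrak g$. (ii) There is exactly one bivector field $\Pi_k$ on $G$ with $\Pi_k^\sharp=\overrightarrow{n}^{\,k}\circ\overrightarrow{r}^{\,\sharp}$; it is a Poisson structure, it is right-invariant, and in fact $\Pi_k=\overrightarrow{r_k}$. -/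

import Mathlib

open scoped Manifold ContDiff

noncomputable section

namespace PoissonNijenhuis

/-! ### Two-vectors on a finite-dimensional vector space -/

section Linear

variable {V W : Type*} [AddCommGroup V] [Module ℝ V] [AddCommGroup W] [Module ℝ W]

/-- A `2`-vector on the finite-dimensional real vector space `V`, i.e. an element of `Λ² V`, seen
as a skew-symmetric bilinear form on the dual space `V*`. -/
@[ext]
structure TwoVector (V : Type*) [AddCommGroup V] [Module ℝ V] where
  /-- the bilinear form on the dual space -/
  form : Module.Dual ℝ V →ₗ[ℝ] Module.Dual ℝ V →ₗ[ℝ] ℝ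
  /-- skew-symmetry -/
  skew : ∀ α β, form α β = -form β α

/-- The linear map `r♯ : V* → V` of a `2`-vector `r`, determined by `⟨α, r♯ β⟩ = r (α, β)`. -/
def TwoVector.sharp [FiniteDimensional ℝ V] (r : TwoVector V) : Module.Dual ℝ V →ₗ[ℝ] V :=
  (Module.evalEquiv ℝ V).symm.toLinearMap ∘ₗ r.form.flip

theorem TwoVector.apply_sharp [FiniteDimensional ℝ V] (r : TwoVector V) (α β : Module.Dual ℝ V) :
    α (r.sharp β) = r.form α β := by
  simp [TwoVector.sharp, Module.apply_evalEquiv_symm_apply]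

/-- The image of a `2`-vector under a linear map `f : V → W`, i.e. `(Λ² f) r`. -/
def TwoVector.map (f : V →ₗ[ℝ] W) (r : TwoVector V) : TwoVector W where
  form := r.form.compl₁₂ f.dualMap f.dualMap
  skew _ _ := r.skew _ _

/-- The algebraic Schouten bracket `⟦r, s⟧` of two `2`-vectors on a Lie algebra, a `3`-vector,
evaluated on `α, β, γ`. On decomposable elements it is
`⟦x₁ ∧ x₂, y₁ ∧ y₂⟧ = ∑ (-1)^(i+j) [xᵢ, yⱼ] ∧ x_(3-i) ∧ y_(3-j)`. -/
def algSchouten [FiniteDimensional ℝ V] [Bracket V V] (r s : TwoVector V)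
    (α β γ : Module.Dual ℝ V) : ℝ :=
  (α ⁅r.sharp β, s.sharp γ⁆ + α ⁅s.sharp β, r.sharp γ⁆) +
  (β ⁅r.sharp γ, s.sharp α⁆ + β ⁅s.sharp γ, r.sharp α⁆) +
  (γ ⁅r.sharp α, s.sharp β⁆ + γ ⁅s.sharp α, r.sharp β⁆)

/-- The classical Yang-Baxter equation `⟦r, r⟧ = 0`. -/
def IsCYBESolution [FiniteDimensional ℝ V] [Bracket V V] (r : TwoVector V) : Prop :=
  ∀ α β γ : Module.Dual ℝ V, algSchouten r r α β γ = 0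

end Linear

/-! ### Tensor fields on a manifold -/

section Fields

variable {E : Type*} [NormedAddCommGroup E] [NormedSpace ℝ E]
  {H : Type*} [TopologicalSpace H] (I : ModelWithCorners ℝ E H)
  {M : Type*} [TopologicalSpace M] [ChartedSpace H M]

instance instFiniteDimensionalTangentSpace [h : FiniteDimensional ℝ E] (x : M) :
    FiniteDimensional ℝ (TangentSpace I x) := h

variable (M)

/-- Vector fields, not necessarily smooth. -/
abbrev VectorFld := (x : M) → TangentSpace I x

/-- Fields of covectors, not necessarily smooth. -/
abbrev OneForm := (x : M) → Module.Dual ℝ (TangentSpace I x)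

/-- Fields of endomorphisms of the tangent spaces, not necessarily smooth. -/
abbrev EndField := (x : M) → Module.End ℝ (TangentSpace I x)

/-- Fields of `2`-vectors, not necessarily smooth. -/
abbrev TwoVectorField := (x : M) → TwoVector (TangentSpace I x)

variable {M} [IsManifold I ∞ M]

/-- The vector field `X` is smooth on `U`, as a section of the tangent bundle. -/
def SmoothVectorOn (X : VectorFld I M) (U : Set M) : Prop :=
  ContMDiffOn I I.tangent ∞ (fun x ↦ (⟨x, X x⟩ : TangentBundle I M)) U

/-- The `1`-form `α` is smooth on the open set `U`: its contraction with every vector field that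
is smooth on some open subset of `U` is a smooth function there. -/
def SmoothFormOn (α : OneForm I M) (U : Set M) : Prop :=
  ∀ U' ⊆ U, IsOpen U' → ∀ X : VectorFld I M, SmoothVectorOn I X U' →
    ContMDiffOn I 𝓘(ℝ, ℝ) ∞ (fun x ↦ α x (X x)) U'

/-- Smooth vector fields on `M`, i.e. membership in `𝔛(M)`. -/
abbrev SmoothVector (X : VectorFld I M) : Prop := SmoothVectorOn I X Set.univ

/-- Smooth `1`-forms on `M`, i.e. membership in `Ω¹(M)`. -/
abbrev SmoothForm (α : OneForm I M) : Prop := SmoothFormOn I α Set.univ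

/-- Smooth `(1,1)`-tensor fields: they send local smooth vector fields to such. -/
def SmoothEnd (N : EndField I M) : Prop :=
  ∀ U : Set M, IsOpen U → ∀ X : VectorFld I M, SmoothVectorOn I X U →
    SmoothVectorOn I (fun x ↦ N x (X x)) U

/-- Smooth bivector fields: they send pairs of local smooth `1`-forms to smooth functions. -/
def SmoothTwoVector (P : TwoVectorField I M) : Prop :=
  ∀ U : Set M, IsOpen U → ∀ α β : OneForm I M, SmoothFormOn I α U → SmoothFormOn I β U →
    ContMDiffOn I 𝓘(ℝ, ℝ) ∞ (fun x ↦ (P x).form (α x) (β x)) U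

/-- The derivative `X f = ⟨df, X⟩` of a function along a vector field. -/
def dirDeriv (X : VectorFld I M) (f : M → ℝ) : M → ℝ := fun x ↦ mfderiv I 𝓘(ℝ, ℝ) f x (X x)

/-- The Lie derivative of a `1`-form, contracted with a vector field:
`⟨ℒ_X α, Y⟩ = X ⟨α, Y⟩ - ⟨α, [X, Y]⟩`. -/
def lieDeriv (X : VectorFld I M) (α : OneForm I M) (Y : VectorFld I M) : M → ℝ := fun x ↦
  dirDeriv I X (fun y ↦ α y (Y y)) x - α x (VectorField.mlieBracket I X Y x)

variable {I}

/-- `N X` for a `(1,1)`-tensor field `N` and a vector field `X`. -/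
def EndField.app (N : EndField I M) (X : VectorFld I M) : VectorFld I M := fun x ↦ N x (X x)

/-- `Nᵗ α` for a `(1,1)`-tensor field `N` and a `1`-form `α`. -/
def EndField.trans (N : EndField I M) (α : OneForm I M) : OneForm I M :=
  fun x ↦ (N x).dualMap (α x)

variable (I) in
/-- The Nijenhuis torsion (half the Frölicher-Nijenhuis bracket of `N` with itself)
`[NX, NY] - N[NX, Y] - N[X, NY] + N²[X, Y]`. -/
def nijenhuisTorsion (N : EndField I M) (X Y : VectorFld I M) : VectorFld I M := fun x ↦
  VectorField.mlieBracket I (N.app X) (N.app Y) x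
    - N x (VectorField.mlieBracket I (N.app X) Y x)
    - N x (VectorField.mlieBracket I X (N.app Y) x)
    + N x (N x (VectorField.mlieBracket I X Y x))

variable [FiniteDimensional ℝ E]

/-- The vector field `P♯ α` for a bivector field `P` and a `1`-form `α`. -/
def TwoVectorField.sharpField (P : TwoVectorField I M) (α : OneForm I M) : VectorFld I M :=
  fun x ↦ (P x).sharp (α x)

variable (I)

/-- The Schouten-Nijenhuis bracket `[P, Q]` of two bivector fields, a trivector field, evaluated
on the `1`-forms `α, β, γ`; on decomposable elements it is
`[X₁ ∧ X₂, Y₁ ∧ Y₂] = ∑ (-1)^(i+j) [Xᵢ, Yⱼ] ∧ X_(3-i) ∧ Y_(3-j)`.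
The expression is the sum over the cyclic permutations of `(α, β, γ)` of
`⟨α, [P♯β, Q♯γ]⟩ + ⟨α, [Q♯β, P♯γ]⟩ + (P♯α)(Q(β, γ)) + (Q♯α)(P(β, γ))`. -/
def schouten (P Q : TwoVectorField I M) (α β γ : OneForm I M) : M → ℝ :=
  let term (a b c : OneForm I M) : M → ℝ := fun x ↦
    a x (VectorField.mlieBracket I (P.sharpField b) (Q.sharpField c) x)
    + a x (VectorField.mlieBracket I (Q.sharpField b) (P.sharpField c) x)
    + dirDeriv I (P.sharpField a) (fun y ↦ (Q y).form (b y) (c y)) x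
    + dirDeriv I (Q.sharpField a) (fun y ↦ (P y).form (b y) (c y)) x
  fun x ↦ term α β γ x + term β γ α x + term γ α β x

/-- The concomitant `C(P, N)(α, β)`, a `1`-form, contracted with the vector field `Z`:
`C(P, N)(α, β) = ℒ_{P♯α}(Nᵗβ) - ℒ_{P♯β}(Nᵗα) + Nᵗℒ_{P♯β}α - Nᵗℒ_{P♯α}β
  + d⟨α, N P♯β⟩ - Nᵗ d⟨α, P♯β⟩`, where `⟨Nᵗ ω, Z⟩ = ⟨ω, N Z⟩`. -/
def concomitant (P : TwoVectorField I M) (N : EndField I M) (α β : OneForm I M)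
    (Z : VectorFld I M) : M → ℝ := fun x ↦
  lieDeriv I (P.sharpField α) (N.trans β) Z x
    - lieDeriv I (P.sharpField β) (N.trans α) Z x
    + lieDeriv I (P.sharpField β) α (N.app Z) x
    - lieDeriv I (P.sharpField α) β (N.app Z) x
    + dirDeriv I Z (fun y ↦ α y (N y ((P y).sharp (β y)))) x
    - dirDeriv I (N.app Z) (fun y ↦ α y ((P y).sharp (β y))) x

/-- Poisson structures: smooth bivector fields with `[P, P] = 0`. -/
structure IsPoisson (P : TwoVectorField I M) : Prop where
  smooth : SmoothTwoVector I P
  schouten_self : ∀ α β γ : OneForm I M, SmoothForm I α → SmoothForm I β → SmoothForm I γ →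
    ∀ x, schouten I P P α β γ x = 0

/-- Poisson-Nijenhuis structures. -/
structure IsPoissonNijenhuis (P : TwoVectorField I M) (N : EndField I M) : Prop where
  poisson : IsPoisson I P
  smooth : SmoothEnd I N
  torsion : ∀ X Y : VectorFld I M, SmoothVector I X → SmoothVector I Y →
    ∀ x, nijenhuisTorsion I N X Y x = 0
  comm : ∀ x, N x ∘ₗ (P x).sharp = (P x).sharp ∘ₗ (N x).dualMap
  concomitant_eq : ∀ (α β : OneForm I M) (Z : VectorFld I M), SmoothForm I α → SmoothForm I β →
    SmoothVector I Z → ∀ x, concomitant I P N α β Z x = 0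

end Fields

/-! ### Right-invariant tensor fields on a Lie group -/

section RightInvariant

variable {E : Type*} [NormedAddCommGroup E] [NormedSpace ℝ E]
  {H : Type*} [TopologicalSpace H] (I : ModelWithCorners ℝ E H)
  {G : Type*} [TopologicalSpace G] [ChartedSpace H G] [Group G]

/-- The differential `T_e R_g : T_e G → T_g G` of the right translation `R_g h = h g`. -/
def rightTr (g : G) : GroupLieAlgebra I G →ₗ[ℝ] TangentSpace I g :=
  (mfderiv I I (fun h : G ↦ h * g) 1).toLinearMap

/-- The differential `T_g R_{g⁻¹} : T_g G → T_e G` of the right translation by `g⁻¹`. -/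
def rightTrInv (g : G) : TangentSpace I g →ₗ[ℝ] GroupLieAlgebra I G :=
  (mfderiv I I (fun h : G ↦ h * g⁻¹) g).toLinearMap

variable {I}

/-- The right-invariant bivector field with value `r` at the identity. -/
def rvecTwoVector (r : TwoVector (GroupLieAlgebra I G)) : TwoVectorField I G :=
  fun g ↦ r.map (rightTr I g)

/-- The right-invariant `(1,1)`-tensor field `N_g = T_e R_g ∘ n ∘ T_g R_{g⁻¹}`. -/
def rvecEnd (n : Module.End ℝ (GroupLieAlgebra I G)) : EndField I G :=
  fun g ↦ rightTr I g ∘ₗ n ∘ₗ rightTrInv I g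

/-- A bivector field is right-invariant if it is generated by some `r ∈ Λ² 𝔤`. -/
def IsRightInvariant (P : TwoVectorField I G) : Prop :=
  ∃ r : TwoVector (GroupLieAlgebra I G), P = rvecTwoVector r

end RightInvariant

end PoissonNijenhuis

end

noncomputable section

namespace PoissonNijenhuis

/-! ### Linear algebra of two-vectors -/

section TwoVectorAlgebra

variable {V W : Type*} [AddCommGroup V] [Module ℝ V] [AddCommGroup W] [Module ℝ W]

/-! The statement reduces to linear algebra on 𝔤. Right-invariant vector fields satisfy [v→, w→] =
-[v, w]→ (`mlieBracket_rvecField`), and an invariant form pairs with an invariant field to a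
constant. Testing the Poisson-Nijenhuis axioms on invariant data therefore kills every derivative of
a function and leaves identities for (r, n) alone: `isAlgPoissonNijenhuis_of_rvec`.

The heart is `IsAlgPoissonNijenhuis.next`: these identities survive replacing r♯ by n ∘ r♯.
Induction then gives the Yang-Baxter equation for every r_k.

For the way back, [Π_k, Π_k] must vanish on all smooth forms, not only on invariant ones.
`schouten_rvecTwoVector` shows that the derivatives of the coefficients cancel by skew-symmetry,
leaving minus the algebraic Schouten bracket.

Uniqueness is injectivity of `sharp`. Existence holds because n r♯ = r♯ nᵗ makes n^k r♯ skew. -/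

theorem TwoVector.sharp_injective [FiniteDimensional ℝ V] :
    Function.Injective (TwoVector.sharp : TwoVector V → _) := by
  intro r s h
  ext α β
  rw [← r.apply_sharp, ← s.apply_sharp, h]

/-- The `2`-vector with a given skew-symmetric sharp map. -/
def TwoVector.ofSharp (S : Module.Dual ℝ V →ₗ[ℝ] V) (hS : ∀ α β : Module.Dual ℝ V, α (S β) = -β (S α)) :
    TwoVector V where
  form := LinearMap.mk₂ ℝ (fun α β ↦ α (S β)) (by simp) (by simp) (by simp) (by simp)
  skew α β := hS α β

theorem TwoVector.sharp_ofSharp [FiniteDimensional ℝ V] (S : Module.Dual ℝ V →ₗ[ℝ] V)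
    (hS : ∀ α β : Module.Dual ℝ V, α (S β) = -β (S α)) : (TwoVector.ofSharp S hS).sharp = S := by
  ext β
  rw [← sub_eq_zero, ← Module.forall_dual_apply_eq_zero_iff ℝ]
  intro α
  rw [map_sub, TwoVector.apply_sharp]
  simp [TwoVector.ofSharp]

theorem TwoVector.apply_sharp_swap [FiniteDimensional ℝ V] (r : TwoVector V)
    (α β : Module.Dual ℝ V) : α (r.sharp β) = -β (r.sharp α) := by
  rw [r.apply_sharp, r.apply_sharp, r.skew]

theorem TwoVector.sharp_map [FiniteDimensional ℝ V] [FiniteDimensional ℝ W] (f : V →ₗ[ℝ] W)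
    (r : TwoVector V) : (r.map f).sharp = f ∘ₗ r.sharp ∘ₗ f.dualMap := by
  ext β
  rw [← sub_eq_zero, ← Module.forall_dual_apply_eq_zero_iff ℝ]
  intro α
  rw [map_sub, TwoVector.apply_sharp]
  have := r.apply_sharp (f.dualMap α) (f.dualMap β)
  simp only [LinearMap.dualMap_apply] at this
  simp [TwoVector.map, this]

variable [FiniteDimensional ℝ V] {r : TwoVector V} {n : Module.End ℝ V}

theorem pow_comp_sharp (h : n ∘ₗ r.sharp = r.sharp ∘ₗ n.dualMap) (k : ℕ) (β : Module.Dual ℝ V) :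
    (n ^ k) (r.sharp β) = r.sharp (β ∘ₗ (n ^ k)) := by
  induction k generalizing β with
  | zero => rfl
  | succ k ih =>
    rw [pow_succ', Module.End.mul_apply, ih, ← LinearMap.comp_apply, h, Module.End.mul_eq_comp,
      ← Module.End.mul_eq_comp, ← pow_succ', pow_succ]
    rfl

/-- Move n^k through r♯ onto the covector, then use the skew-symmetry of r. This is what makes r_k
exist. -/
theorem pow_comp_sharp_skew (h : n ∘ₗ r.sharp = r.sharp ∘ₗ n.dualMap) (k : ℕ)
    (α β : Module.Dual ℝ V) :
    α (((n ^ k) ∘ₗ r.sharp) β) = -β (((n ^ k) ∘ₗ r.sharp) α) := by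
  have := r.apply_sharp_swap (α ∘ₗ (n ^ k)) β
  rw [LinearMap.comp_apply, LinearMap.comp_apply, pow_comp_sharp h k α]
  exact this

/-- The algebraic counterpart, on a Lie algebra, of a Poisson-Nijenhuis structure. -/
structure IsAlgPoissonNijenhuis [Bracket V V] (r : TwoVector V) (n : Module.End ℝ V) : Prop where
  cybe : IsCYBESolution r
  torsion : ∀ x y : V, ⁅n x, n y⁆ - n ⁅n x, y⁆ - n ⁅x, n y⁆ + n (n ⁅x, y⁆) = 0
  comm : n ∘ₗ r.sharp = r.sharp ∘ₗ n.dualMap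
  concomitant : ∀ (α β : Module.Dual ℝ V) (z : V),
    β (⁅r.sharp α, n z⁆ - n ⁅r.sharp α, z⁆) = α (⁅r.sharp β, n z⁆ - n ⁅r.sharp β, z⁆)

theorem IsCYBESolution.cyclic_sum [Bracket V V] (h : IsCYBESolution r)
    (α β γ : Module.Dual ℝ V) :
    α ⁅r.sharp β, r.sharp γ⁆ + β ⁅r.sharp γ, r.sharp α⁆ + γ ⁅r.sharp α, r.sharp β⁆ = 0 := by
  have := h α β γ
  unfold algSchouten at this
  linarith

/-- The pair `(n ∘ r♯, n)` is Poisson-Nijenhuis if `(r, n)` is. -/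
theorem IsAlgPoissonNijenhuis.next [Bracket V V] (skew : ∀ x y : V, ⁅x, y⁆ = -⁅y, x⁆)
    (h : IsAlgPoissonNijenhuis r n) {s : TwoVector V} (hs : s.sharp = n ∘ₗ r.sharp) :
    IsAlgPoissonNijenhuis s n := by
  have hc (β : Module.Dual ℝ V) : r.sharp (β ∘ₗ n) = n (r.sharp β) :=
    (LinearMap.congr_fun h.comm β).symm
  have hs' (β : Module.Dual ℝ V) : s.sharp β = n (r.sharp β) := LinearMap.congr_fun hs β
  have ht (ξ : Module.Dual ℝ V) (x y : V) :
      ξ ⁅n x, n y⁆ - ξ (n ⁅n x, y⁆) - ξ (n ⁅x, n y⁆) + ξ (n (n ⁅x, y⁆)) = 0 := by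
    rw [← map_sub, ← map_sub, ← map_add, h.torsion, map_zero]
  refine ⟨?_, h.torsion, ?_, ?_⟩
  · have sk (ξ : Module.Dual ℝ V) (x y : V) : ξ ⁅x, y⁆ = -ξ ⁅y, x⁆ := by rw [skew, map_neg]
    -- The Yang-Baxter equation at (α, β, nᵗγ) contains α[r♯β, n r♯γ] - β[r♯α, n r♯γ]; the
    -- concomitant identity at z = r♯γ trades this difference for terms with n outside the bracket.
    have U (α β γ : Module.Dual ℝ V) : α (n ⁅r.sharp β, r.sharp γ⁆) +
        β (n ⁅r.sharp γ, r.sharp α⁆) + γ (n ⁅r.sharp α, r.sharp β⁆) = 0 := by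
      have h1 := h.cybe.cyclic_sum α β (γ ∘ₗ n)
      have h2 := h.concomitant α β (r.sharp γ)
      simp only [hc, LinearMap.comp_apply, map_sub] at h1 h2
      have h3 := sk β (n (r.sharp γ)) (r.sharp α)
      have h4 := sk (β ∘ₗ n) (r.sharp γ) (r.sharp α)
      simp only [LinearMap.comp_apply] at h4
      linarith
    intro α β γ
    -- Let A be the cyclic sum of α[n r♯β, n r♯γ], B that of αn[n r♯β, r♯γ] + αn[r♯β, n r♯γ], and C
    -- that of αn²[r♯β, r♯γ]. The three groups below add up to A + B = 0, B + C = 0 and A - B + C =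
    -- 0, which force A = B = C = 0.
    have c1 := h.cybe.cyclic_sum (α ∘ₗ n) β (γ ∘ₗ n)
    have c2 := h.cybe.cyclic_sum α (β ∘ₗ n) (γ ∘ₗ n)
    have c3 := h.cybe.cyclic_sum (α ∘ₗ n) (β ∘ₗ n) γ
    have u1 := U α β (γ ∘ₗ n)
    have u2 := U α (β ∘ₗ n) γ
    have u3 := U (α ∘ₗ n) β γ
    have t1 := ht γ (r.sharp α) (r.sharp β)
    have t2 := ht α (r.sharp β) (r.sharp γ)
    have t3 := ht β (r.sharp γ) (r.sharp α)
    simp only [hc, LinearMap.comp_apply] at c1 c2 c3 u1 u2 u3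
    simp only [algSchouten, hs']
    linarith
  · ext β
    have h1 := hs' (β ∘ₗ n)
    rw [hc] at h1
    change n (s.sharp β) = s.sharp (β ∘ₗ n)
    rw [h1, hs']
  · intro α β z
    -- Zero torsion reads [nx, nz] - n[nx, z] = n([x, nz] - n[x, z]), so the identity for n r♯
    -- follows from the old one with nᵗ applied to one covector.
    have h1 := h.concomitant α (β ∘ₗ n) z
    have t1 := ht α (r.sharp β) z
    have h2 := h.concomitant (α ∘ₗ n) β z
    have t2 := ht β (r.sharp α) z
    simp only [hc, LinearMap.comp_apply, map_sub, hs'] at *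
    linarith

theorem IsAlgPoissonNijenhuis.iterate [Bracket V V] (skew : ∀ x y : V, ⁅x, y⁆ = -⁅y, x⁆)
    (h : IsAlgPoissonNijenhuis r n) (k : ℕ) {s : TwoVector V}
    (hs : s.sharp = (n ^ k) ∘ₗ r.sharp) : IsAlgPoissonNijenhuis s n := by
  induction k generalizing s with
  | zero =>
    obtain rfl : s = r := TwoVector.sharp_injective hs
    exact h
  | succ k ih =>
    refine (ih (TwoVector.sharp_ofSharp _ (pow_comp_sharp_skew h.comm k))).next skew ?_
    rw [hs, TwoVector.sharp_ofSharp, pow_succ']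
    rfl

end TwoVectorAlgebra

/-! ### Right-invariant vector fields and forms -/

section Translations

variable {E : Type*} [NormedAddCommGroup E] [NormedSpace ℝ E]
  {H : Type*} [TopologicalSpace H] {I : ModelWithCorners ℝ E H}
  {G : Type*} [TopologicalSpace G] [ChartedSpace H G]

/-- Every tangent space is definitionally `E`. Comparing values in `E`, with the base point given by
an equation, avoids transport between fibres. -/
theorem mfderiv_comp_apply_of_eq {f g : G → G} {x y : G} (hg : MDifferentiableAt I I g y)
    (hf : MDifferentiableAt I I f x) (hy : f x = y) (v : TangentSpace I x) :
    (mfderiv I I (g ∘ f) x v : E) = (mfderiv I I g y (mfderiv I I f x v : E) : E) := by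
  subst hy
  exact mfderiv_comp_apply x hg hf v

theorem mfderiv_apply_of_eq_id {f : G → G} (hf : f = id) (x : G) (v : TangentSpace I x) :
    (mfderiv I I f x v : E) = v := by
  subst hf
  rw [mfderiv_id]
  rfl

variable [Group G]

/-- The right-invariant vector field with value `v` at the identity. -/
def rvecField (v : GroupLieAlgebra I G) : VectorFld I G := fun g ↦ rightTr I g v

/-- The right-invariant `1`-form with value `ξ` at the identity. -/
def rvecForm (ξ : Module.Dual ℝ (GroupLieAlgebra I G)) : OneForm I G :=
  fun g ↦ ξ ∘ₗ rightTrInv I g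

/-- A `1`-form, read at `g` in the trivialization of the cotangent bundle by right translations. -/
def formAtOne (α : OneForm I G) (g : G) : Module.Dual ℝ (GroupLieAlgebra I G) :=
  α g ∘ₗ rightTr I g

variable [LieGroup I ∞ G]

theorem mdifferentiable_mul_right' (g : G) : MDifferentiable I I (fun h : G ↦ h * g) :=
  (contMDiff_mul_right (n := ∞)).mdifferentiable (by simp)

theorem mdifferentiable_mul_left' (g : G) : MDifferentiable I I (fun h : G ↦ g * h) :=
  (contMDiff_mul_left (n := ∞)).mdifferentiable (by simp)

variable (I G) in
theorem mdifferentiable_inv' : MDifferentiable I I (fun h : G ↦ h⁻¹) :=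
  (contMDiff_inv I ∞).mdifferentiable (by simp)

theorem rightTrInv_rightTr (g : G) (v : GroupLieAlgebra I G) :
    rightTrInv I g (rightTr I g v) = v := by
  have h := mfderiv_comp_apply_of_eq (I := I) (mdifferentiable_mul_right' g⁻¹ g)
    (mdifferentiable_mul_right' g 1) (one_mul g) v
  have e : (fun h : G ↦ h * g⁻¹) ∘ (fun h : G ↦ h * g) = id := by ext; simp
  rw [e, mfderiv_id] at h
  exact h.symm

theorem rightTr_injective (g : G) : Function.Injective (rightTr I g) :=
  Function.LeftInverse.injective (rightTrInv_rightTr g)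

/-- Differentiate h * h⁻¹ = 1 at the identity. -/
theorem mfderiv_inv_one (v : GroupLieAlgebra I G) :
    (mfderiv I I (fun h : G ↦ h⁻¹) 1 v : E) = -v := by
  have hm : MDifferentiableAt (I.prod I) I (fun p : G × G ↦ p.1 * p.2) (1, (1 : G)⁻¹) :=
    (contMDiff_mul I ∞).mdifferentiable (by simp) _
  have hi := mdifferentiable_inv' I G 1
  have h := mfderiv_comp_apply (1 : G) (f := fun h : G ↦ (h, h⁻¹)) hm
    (mdifferentiableAt_id.prodMk hi) v
  have e : (fun p : G × G ↦ p.1 * p.2) ∘ (fun h : G ↦ (h, h⁻¹)) = fun _ ↦ 1 := by ext; simp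
  have hp : mfderiv I (I.prod I) (fun h : G ↦ (h, h⁻¹)) 1 = _ :=
    mfderiv_prodMk mdifferentiableAt_id hi
  rw [e, mfderiv_const, hp, mfderiv_prod_eq_add_apply hm] at h
  -- Both partial derivatives of the multiplication at (1, 1⁻¹) are the identity.
  have h1 := mfderiv_apply_of_eq_id (I := I) (f := fun h : G ↦ h * (1 : G)⁻¹) (by ext; simp) 1 v
  have h2 := mfderiv_apply_of_eq_id (I := I) (f := fun h : G ↦ 1 * h) (by ext; simp) (1 : G)⁻¹
    (mfderiv I I (fun h : G ↦ h⁻¹) 1 v)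
  have h3 : (0 : E) = @HAdd.hAdd E E E _ v (mfderiv I I (fun h : G ↦ h⁻¹) 1 v) := by
    refine h.trans (congrArg₂ (fun a b : E ↦ a + b) ?_ h2)
    refine Eq.trans ?_ h1
    exact congrArg (mfderiv I I (fun h : G ↦ h * (1 : G)⁻¹) 1)
      (mfderiv_apply_of_eq_id (I := I) rfl (1 : G) v)
  exact eq_neg_of_add_eq_zero_right h3.symm

/-- Since (hg)⁻¹ = g⁻¹h⁻¹, inversion exchanges right and left translations; the sign is that of its
differential at 1. -/
theorem mfderiv_inv_rvecField (g : G) (v : GroupLieAlgebra I G) :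
    (mfderiv I I (fun h : G ↦ h⁻¹) g (rvecField v g) : E) = -mulInvariantVectorField v g⁻¹ := by
  have h := mfderiv_comp_apply_of_eq (I := I) (mdifferentiable_inv' I G g)
    (mdifferentiable_mul_right' g 1) (one_mul g) v
  have h' := mfderiv_comp_apply_of_eq (I := I) (mdifferentiable_mul_left' g⁻¹ 1)
    (mdifferentiable_inv' I G 1) inv_one v
  have e : (fun h : G ↦ h⁻¹) ∘ (fun h : G ↦ h * g) =
    (fun h : G ↦ g⁻¹ * h) ∘ (fun h : G ↦ h⁻¹) := by ext; simp
  rw [e, h', mfderiv_inv_one] at h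
  refine h.symm.trans ?_
  exact map_neg (mfderiv I I (fun h : G ↦ g⁻¹ * h) 1) v

/-- The bracket of 𝔤 is defined through left-invariant fields; pulling back by inversion carries it
to right-invariant ones. -/
theorem mpullback_inv_mulInvariantVectorField (v : GroupLieAlgebra I G) :
    VectorField.mpullback I I (fun h : G ↦ h⁻¹) (mulInvariantVectorField v) = -rvecField v := by
  ext g
  have e : (fun h : G ↦ h⁻¹) ∘ (fun h : G ↦ h⁻¹) = id := by ext; simp
  have h1 {y z : G} (hy : y⁻¹ = z) (w : E) : (mfderiv I I (fun h : G ↦ h⁻¹) z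
      (mfderiv I I (fun h : G ↦ h⁻¹) y w : E) : E) = w := by
    have := mfderiv_comp_apply_of_eq (I := I) (mdifferentiable_inv' I G z)
      (mdifferentiable_inv' I G y) hy w
    rw [e, mfderiv_id] at this
    exact this.symm
  -- Inversion is an involution, so its differential at g⁻¹ inverts the one at g.
  have h2 : (mfderiv I I (fun h : G ↦ h⁻¹) g).inverse
      = mfderiv I I (fun h : G ↦ h⁻¹) g⁻¹ :=
    ContinuousLinearMap.inverse_eq (ContinuousLinearMap.ext fun w ↦ h1 (inv_inv g) w)
      (ContinuousLinearMap.ext fun w ↦ h1 rfl w)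
  have h3 := congrArg (mfderiv I I (fun h : G ↦ h⁻¹) g⁻¹ : E → E) (mfderiv_inv_rvecField g v)
  have h4 := h1 (y := g) rfl (rvecField v g)
  rw [VectorField.mpullback_apply, h2]
  refine neg_eq_iff_eq_neg.mp ?_
  refine Eq.trans ?_ (h3.symm.trans h4)
  exact (map_neg (mfderiv I I (fun h : G ↦ h⁻¹) g⁻¹) (mulInvariantVectorField v g⁻¹)).symm

end Translations

/-! ### Smoothness of right-invariant vector fields and forms -/

section Smoothness

open Bundle

variable {E : Type*} [NormedAddCommGroup E] [NormedSpace ℝ E]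
  {H : Type*} [TopologicalSpace H] {I : ModelWithCorners ℝ E H}
  {G : Type*} [TopologicalSpace G] [ChartedSpace H G] [Group G] [LieGroup I ∞ G]

/-- The field is the tangent map of multiplication applied to the smooth section g ↦ ((1, v), (g,
0)). -/
theorem smoothVectorOn_rvecField (v : GroupLieAlgebra I G) (U : Set G) :
    SmoothVectorOn I (rvecField v) U := by
  have hmul := contMDiff_mul (G := G) I ∞
  have h1 : ContMDiff I (I.tangent.prod I.tangent) ∞ (fun g : G ↦
      ((⟨1, v⟩ : TangentBundle I G), (⟨g, 0⟩ : TangentBundle I G))) :=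
    contMDiff_const.prodMk (contMDiff_zeroSection ℝ (TangentSpace I))
  have h2 := (hmul.contMDiff_tangentMap (m := ∞) le_rfl).comp
    ((contMDiff_equivTangentBundleProd_symm (n := ∞)).comp h1)
  refine ContMDiff.contMDiffOn ?_
  convert! h2 with g
  · simp
  · simp only [Function.comp_apply, tangentMap]
    rw [mfderiv_prod_eq_add_apply (hmul.mdifferentiable (by simp) _)]
    exact ((congrArg (fun b : E ↦ @HAdd.hAdd E E E _ (rightTr I g v) b)
      (map_zero (mfderiv I I (fun z : G ↦ 1 * z) g))).trans (add_zero _)).symm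

/-- The vector T R_{g⁻¹}(X g) is the image of (X g, 0) at (g, g) under the tangent map of (p, q) ↦ p
q⁻¹, so it depends smoothly on g inside the fixed fibre over 1. -/
theorem smoothFormOn_rvecForm [FiniteDimensional ℝ E]
    (ξ : Module.Dual ℝ (GroupLieAlgebra I G)) (V : Set G) : SmoothFormOn I (rvecForm ξ) V := by
  intro U _ _ X hX
  have hdiv : ContMDiff (I.prod I) I ∞ (fun p : G × G ↦ p.1 * p.2⁻¹) :=
    contMDiff_fst.mul contMDiff_snd.inv
  have h1 : ContMDiffOn I (I.tangent.prod I.tangent) ∞ (fun g : G ↦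
      ((⟨g, X g⟩ : TangentBundle I G), (⟨g, 0⟩ : TangentBundle I G))) U :=
    hX.prodMk (contMDiff_zeroSection ℝ (TangentSpace I)).contMDiffOn
  have h2 := (hdiv.contMDiff_tangentMap (m := ∞) le_rfl).comp_contMDiffOn
    ((contMDiff_equivTangentBundleProd_symm (n := ∞)).comp_contMDiffOn h1)
  have h3 : ContMDiffOn I I.tangent ∞
      (fun g : G ↦ (⟨1, rightTrInv I g (X g)⟩ : TangentBundle I G)) U := by
    convert! h2 with g
    · simp
    · simp only [Function.comp_apply, tangentMap]
      rw [mfderiv_prod_eq_add_apply (hdiv.mdifferentiable (by simp) _)]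
      exact ((congrArg (fun b : E ↦ @HAdd.hAdd E E E _ (rightTrInv I g (X g)) b)
        (map_zero (mfderiv I I (fun z : G ↦ g * z⁻¹) g))).trans (add_zero _)).symm
  -- The trivialization at 1 turns a smooth curve of points of the fibre over 1 into a smooth map to
  -- `E`; ζ is ξ read through it, continuous by finite dimension.
  have hb : (1 : G) ∈ (trivializationAt E (TangentSpace I) (1 : G)).baseSet :=
    FiberBundle.mem_baseSet_trivializationAt' 1
  let L := (trivializationAt E (TangentSpace I) (1 : G)).continuousLinearEquivAt ℝ 1 hb
  let ζ : E →L[ℝ] ℝ := LinearMap.toContinuousLinearMap (ξ ∘ₗ L.symm.toLinearMap)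
  intro g hg
  have h4 := (contMDiffWithinAt_totalSpace.1 (h3 g hg)).2
  have h5 := ζ.contMDiff.contMDiffAt.comp_contMDiffWithinAt g h4
  refine h5.congr_of_eventuallyEq (.of_forall fun y ↦ ?_) ?_
  all_goals
    exact congrArg ξ (L.symm_apply_apply _).symm

end Smoothness

/-! ### Lie brackets in terms of right-invariant frames -/

section Brackets

open VectorField

variable {E : Type*} [NormedAddCommGroup E] [NormedSpace ℝ E]
  {H : Type*} [TopologicalSpace H] {I : ModelWithCorners ℝ E H}

theorem mvfderiv_sum_mul {M : Type*} [TopologicalSpace M] [ChartedSpace H M] {ι : Type*}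
    (s : Finset ι) {f g : ι → M → ℝ} {x : M} (hf : ∀ i, MDifferentiableAt I 𝓘(ℝ, ℝ) (f i) x)
    (hg : ∀ i, MDifferentiableAt I 𝓘(ℝ, ℝ) (g i) x) :
    MDifferentiableAt I 𝓘(ℝ, ℝ) (fun y ↦ ∑ i ∈ s, f i y * g i y) x ∧
    ∀ v, mvfderiv I (fun y ↦ ∑ i ∈ s, f i y * g i y) x v =
      ∑ i ∈ s, (f i x * mvfderiv I (g i) x v + mvfderiv I (f i) x v * g i x) := by
  classical
  induction s using Finset.induction_on with
  | empty =>
    simp only [Finset.sum_empty]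
    exact ⟨mdifferentiableAt_const, fun v ↦ by simp [mvfderiv_const]⟩
  | insert i s hi ih =>
    have e : (fun y ↦ ∑ j ∈ insert i s, f j y * g j y) =
      f i * g i + fun y ↦ ∑ j ∈ s, f j y * g j y := by
      ext y; simp [Finset.sum_insert hi]
    have hm : MDifferentiableAt I 𝓘(ℝ, ℝ) (f i * g i) x := (hf i).mul (hg i)
    rw [e]
    refine ⟨hm.add ih.1, fun v ↦ ?_⟩
    rw [mvfderiv_add hm ih.1, mvfderiv_mul (hf i) (hg i), Finset.sum_insert hi]
    simp [ih.2, mul_comm]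

theorem mlieBracket_sum_smul_right [FiniteDimensional ℝ E] {M : Type*} [TopologicalSpace M] [ChartedSpace H M]
    [IsManifold I ∞ M] {ι : Type*} (s : Finset ι) (V : VectorFld I M)
    {f : ι → M → ℝ} {W : ι → VectorFld I M} {x : M}
    (hf : ∀ i, MDifferentiableAt I 𝓘(ℝ, ℝ) (f i) x)
    (hW : ∀ i, MDifferentiableAt I I.tangent (fun y ↦ (⟨y, W i y⟩ : TangentBundle I M)) x) :
    MDifferentiableAt I I.tangent
      (fun y ↦ (⟨y, ∑ i ∈ s, f i y • W i y⟩ : TangentBundle I M)) x ∧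
    mlieBracket I V (fun y ↦ ∑ i ∈ s, f i y • W i y) x =
      ∑ i ∈ s, (mvfderiv I (f i) x (V x) • W i x + f i x • mlieBracket I V (W i) x) := by
  classical
  have hs (i : ι) : MDifferentiableAt I I.tangent
      (fun y ↦ (⟨y, (f i • W i) y⟩ : TangentBundle I M)) x := (hf i).smul_section (hW i)
  have hd (s : Finset ι) : MDifferentiableAt I I.tangent
      (fun y ↦ (⟨y, ∑ i ∈ s, f i y • W i y⟩ : TangentBundle I M)) x :=
    .sum_section fun i _ ↦ hs i
  refine ⟨hd s, ?_⟩
  induction s using Finset.induction_on with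
  | empty =>
    simp only [Finset.sum_empty]
    exact congrFun (mlieBracket_zero_right (I := I) (W := V)) x
  | insert i s hi ih =>
    have e : (fun y ↦ ∑ j ∈ insert i s, f j y • W j y) =
      f i • W i + fun y ↦ ∑ j ∈ s, f j y • W j y := by
      ext y; simp [Finset.sum_insert hi]
    rw [e, mlieBracket_add_right (hs i) (hd s), mlieBracket_smul_right (hf i) (hW i),
      Finset.sum_insert hi, ih]

variable {G : Type*} [TopologicalSpace G] [ChartedSpace H G] [Group G]

theorem lie_swap (v w : GroupLieAlgebra I G) : ⁅v, w⁆ = -⁅w, v⁆ := by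
  rw [GroupLieAlgebra.bracket_def, mlieBracket_swap]
  rfl

variable [LieGroup I ∞ G]

theorem lieGroup_minSmoothness : LieGroup I (minSmoothness ℝ 3) G := by
  rw [minSmoothness_of_isRCLikeNormedField]
  exact LieGroup.of_le (n := ∞) ENat.LEInfty.out

theorem mdifferentiableAt_rvecField (v : GroupLieAlgebra I G) (g : G) :
    MDifferentiableAt I I.tangent (fun y ↦ (⟨y, rvecField v y⟩ : TangentBundle I G)) g :=
  ((smoothVectorOn_rvecField v Set.univ).contMDiffAt Filter.univ_mem).mdifferentiableAt
    (by simp)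

variable [FiniteDimensional ℝ E]

/-- Pullback by inversion preserves brackets and sends left-invariant fields to minus
right-invariant ones: the two signs inside the bracket cancel, and the outer one stays. -/
theorem mlieBracket_rvecField (v w : GroupLieAlgebra I G) (g : G) :
    mlieBracket I (rvecField v) (rvecField w) g = -rvecField ⁅v, w⁆ g := by
  have : LieGroup I (minSmoothness ℝ 3) G := lieGroup_minSmoothness
  have h := mpullback_mlieBracket (I := I) (I' := I) (n := ∞) (f := fun h : G ↦ h⁻¹) (x₀ := g)
    (mdifferentiableAt_mulInvariantVectorField v) (mdifferentiableAt_mulInvariantVectorField w)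
    (contMDiff_inv I ∞).contMDiffAt
    (by rw [minSmoothness_of_isRCLikeNormedField]; exact ENat.LEInfty.out)
  rw [← mulInvariantVector_mlieBracket, mpullback_inv_mulInvariantVectorField,
    mpullback_inv_mulInvariantVectorField, mpullback_inv_mulInvariantVectorField] at h
  have hn (u : GroupLieAlgebra I G) : -rvecField u = (-1 : ℝ) • rvecField u := by simp
  rw [hn v, hn w, mlieBracket_const_smul_left (mdifferentiableAt_rvecField v g),
    mlieBracket_const_smul_right (mdifferentiableAt_rvecField w g)] at h
  rw [GroupLieAlgebra.bracket_def]
  simpa using h.symm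

theorem lie_sum_smul {ι : Type*} (s : Finset ι) (v : GroupLieAlgebra I G) (c : ι → ℝ)
    (w : ι → GroupLieAlgebra I G) : ⁅v, ∑ i ∈ s, c i • w i⁆ = ∑ i ∈ s, c i • ⁅v, w i⁆ := by
  have : LieGroup I (minSmoothness ℝ 3) G := lieGroup_minSmoothness
  have := map_sum (LieModule.toEnd ℝ (GroupLieAlgebra I G) (GroupLieAlgebra I G) v)
    (fun i ↦ c i • w i) s
  simpa only [LieModule.toEnd_apply_apply, lie_smul] using this

end Brackets

/-! ### The Schouten bracket of right-invariant bivector fields -/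

section Schouten

open VectorField Module

variable {E : Type*} [NormedAddCommGroup E] [NormedSpace ℝ E]
  {H : Type*} [TopologicalSpace H] {I : ModelWithCorners ℝ E H}
  {G : Type*} [TopologicalSpace G] [ChartedSpace H G] [Group G]

theorem dual_sum_coord {V : Type*} [AddCommGroup V] [Module ℝ V] [FiniteDimensional ℝ V]
    (ξ : Dual ℝ V) : ξ = ∑ i, ξ (finBasis ℝ V i) • (finBasis ℝ V).coord i := by
  simp

theorem contMDiffOn_formAtOne [LieGroup I ∞ G] {α : OneForm I G} {U : Set G} (hU : IsOpen U)
    (hα : SmoothFormOn I α U) (v : GroupLieAlgebra I G) :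
    ContMDiffOn I 𝓘(ℝ, ℝ) ∞ (fun g ↦ formAtOne α g v) U :=
  hα U subset_rfl hU _ (smoothVectorOn_rvecField v U)

theorem mdifferentiableAt_formAtOne [LieGroup I ∞ G] {α : OneForm I G} (hα : SmoothForm I α) (g : G)
    (v : GroupLieAlgebra I G) : MDifferentiableAt I 𝓘(ℝ, ℝ) (fun g ↦ formAtOne α g v) g :=
  ((contMDiffOn_formAtOne isOpen_univ hα v).contMDiffAt Filter.univ_mem).mdifferentiableAt
    (by simp)

variable [FiniteDimensional ℝ E]

theorem sharpField_rvecTwoVector (r : TwoVector (GroupLieAlgebra I G)) (α : OneForm I G) (g : G) :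
    (rvecTwoVector r).sharpField α g = rightTr I g (r.sharp (formAtOne α g)) := by
  rw [TwoVectorField.sharpField, rvecTwoVector, TwoVector.sharp_map]
  rfl

/-- The derivative at `g` of a `1`-form read in the trivialization by right translations. -/
def formDeriv (α : OneForm I G) (g : G) :
    TangentSpace I g →ₗ[ℝ] Dual ℝ (GroupLieAlgebra I G) :=
  ∑ i, (mvfderiv I (fun y ↦ formAtOne α y (finBasis ℝ _ i)) g).toLinearMap.smulRight
    ((finBasis ℝ (GroupLieAlgebra I G)).coord i)

theorem formDeriv_apply (α : OneForm I G) (g : G) (v : TangentSpace I g) :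
    formDeriv α g v = ∑ i, mvfderiv I (fun y ↦ formAtOne α y (finBasis ℝ _ i)) g v •
      (finBasis ℝ (GroupLieAlgebra I G)).coord i := by
  simp [formDeriv]

/-- Function coefficients against invariant fields: brackets then follow from the Leibniz rule and
`mlieBracket_rvecField`. -/
theorem sharpField_eq_sum (r : TwoVector (GroupLieAlgebra I G)) (α : OneForm I G) :
    (rvecTwoVector r).sharpField α = fun y ↦ ∑ i, formAtOne α y (finBasis ℝ _ i) •
      rvecField (r.sharp ((finBasis ℝ _).coord i)) y := by
  ext y
  rw [sharpField_rvecTwoVector]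
  conv_lhs => rw [dual_sum_coord (formAtOne α y)]
  -- The excluded simp lemma would fold the coordinate expansion back.
  simp [rvecField, -Basis.sum_dual_apply_smul_coord]

variable [LieGroup I ∞ G]

theorem smoothTwoVector_rvecTwoVector (r : TwoVector (GroupLieAlgebra I G)) :
    SmoothTwoVector I (rvecTwoVector r : TwoVectorField I G) := by
  intro U hU α β hα hβ
  have e (g : G) : (rvecTwoVector r g).form (α g) (β g) =
      ∑ i, ∑ j, formAtOne α g (finBasis ℝ _ i) * (formAtOne β g (finBasis ℝ _ j) *
        r.form ((finBasis ℝ _).coord i) ((finBasis ℝ _).coord j)) := by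
    change r.form (formAtOne α g) (formAtOne β g) = _
    conv_lhs => rw [dual_sum_coord (formAtOne α g), dual_sum_coord (formAtOne β g)]
    simp only [map_sum, map_smul, LinearMap.sum_apply, LinearMap.smul_apply, smul_eq_mul,
      Finset.mul_sum]
    rw [Finset.sum_comm]
    exact Finset.sum_congr rfl fun i _ ↦ Finset.sum_congr rfl fun j _ ↦ mul_left_comm _ _ _
  simp only [e]
  refine contMDiffOn_finsetSum fun i _ ↦ contMDiffOn_finsetSum fun j _ ↦ ?_
  exact (contMDiffOn_formAtOne hU hα _).mul
    ((contMDiffOn_formAtOne hU hβ _).mul contMDiffOn_const)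

/-- Smooth `1`-forms have differentiable coefficients, with derivative given by `formDeriv`. -/
theorem mvfderiv_dual_formAtOne {α : OneForm I G} (hα : SmoothForm I α) (g : G)
    (η : Dual ℝ (Dual ℝ (GroupLieAlgebra I G))) :
    MDifferentiableAt I 𝓘(ℝ, ℝ) (fun y ↦ η (formAtOne α y)) g ∧
    ∀ v, mvfderiv I (fun y ↦ η (formAtOne α y)) g v = η (formDeriv α g v) := by
  have e : (fun y ↦ η (formAtOne α y)) = fun y ↦ ∑ i, formAtOne α y (finBasis ℝ _ i) *
      η ((finBasis ℝ (GroupLieAlgebra I G)).coord i) := by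
    ext y
    conv_lhs => rw [dual_sum_coord (formAtOne α y)]
    simp [-Basis.sum_dual_apply_smul_coord]
  have h := mvfderiv_sum_mul (I := I) (x := g) Finset.univ
    (fun i ↦ mdifferentiableAt_formAtOne hα g (finBasis ℝ _ i))
    (g := fun i _ ↦ η ((finBasis ℝ (GroupLieAlgebra I G)).coord i))
    (fun i ↦ mdifferentiableAt_const)
  rw [e]
  refine ⟨h.1, fun v ↦ ?_⟩
  rw [h.2, formDeriv_apply]
  simp [mvfderiv_const]

theorem dirDeriv_rvecTwoVector (r : TwoVector (GroupLieAlgebra I G)) {β γ : OneForm I G}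
    (hβ : SmoothForm I β) (hγ : SmoothForm I γ) (X : VectorFld I G) (g : G) :
    dirDeriv I X (fun y ↦ (rvecTwoVector r y).form (β y) (γ y)) g =
      r.form (formDeriv β g (X g)) (formAtOne γ g) +
      r.form (formAtOne β g) (formDeriv γ g (X g)) := by
  have e : (fun y ↦ (rvecTwoVector r y).form (β y) (γ y)) = fun y ↦
      ∑ i, formAtOne β y (finBasis ℝ _ i) * r.form ((finBasis ℝ _).coord i) (formAtOne γ y) := by
    ext y
    change r.form (formAtOne β y) (formAtOne γ y) = _
    conv_lhs => rw [dual_sum_coord (formAtOne β y)]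
    simp [-Basis.sum_dual_apply_smul_coord]
  have h := (mvfderiv_sum_mul (I := I) (x := g) Finset.univ
    (fun i ↦ mdifferentiableAt_formAtOne hβ g (finBasis ℝ _ i))
    (fun i ↦ (mvfderiv_dual_formAtOne hγ g (r.form ((finBasis ℝ _).coord i))).1)).2 (X g)
  rw [e]
  refine h.trans ?_
  conv_rhs => rw [dual_sum_coord (formAtOne β g), formDeriv_apply]
  simp [(mvfderiv_dual_formAtOne hγ g _).2, Finset.sum_add_distrib, add_comm,
    -Basis.sum_dual_apply_smul_coord]

theorem mlieBracket_sharpField (r : TwoVector (GroupLieAlgebra I G)) {γ : OneForm I G}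
    (hγ : SmoothForm I γ) (V : VectorFld I G) (g : G) :
    mlieBracket I V ((rvecTwoVector r).sharpField γ) g =
      rightTr I g (r.sharp (formDeriv γ g (V g))) + ∑ i, formAtOne γ g (finBasis ℝ _ i) •
        mlieBracket I V (rvecField (r.sharp ((finBasis ℝ _).coord i))) g := by
  rw [sharpField_eq_sum, (mlieBracket_sum_smul_right Finset.univ V
    (fun i ↦ mdifferentiableAt_formAtOne hγ g (finBasis ℝ _ i))
    (fun i ↦ mdifferentiableAt_rvecField (r.sharp ((finBasis ℝ _).coord i)) g)).2,
    Finset.sum_add_distrib, formDeriv_apply]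
  simp [rvecField]

theorem mlieBracket_sharpField_rvecField (r : TwoVector (GroupLieAlgebra I G)) {β : OneForm I G}
    (hβ : SmoothForm I β) (w : GroupLieAlgebra I G) (g : G) :
    mlieBracket I ((rvecTwoVector r).sharpField β) (rvecField w) g =
      -rightTr I g (r.sharp (formDeriv β g (rvecField w g))) -
        rightTr I g ⁅r.sharp (formAtOne β g), w⁆ := by
  rw [mlieBracket_swap, Pi.neg_apply, mlieBracket_sharpField r hβ, lie_swap,
    dual_sum_coord (formAtOne β g), map_sum]
  simp only [map_smul, lie_sum_smul, mlieBracket_rvecField, ← dual_sum_coord]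
  simp [rvecField]
  abel

theorem mlieBracket_sharpField_sharpField (r : TwoVector (GroupLieAlgebra I G))
    {β γ : OneForm I G} (hβ : SmoothForm I β) (hγ : SmoothForm I γ) (g : G) :
    mlieBracket I ((rvecTwoVector r).sharpField β) ((rvecTwoVector r).sharpField γ) g =
      rightTr I g (r.sharp (formDeriv γ g ((rvecTwoVector r).sharpField β g)) -
        r.sharp (formDeriv β g ((rvecTwoVector r).sharpField γ g)) -
        ⁅r.sharp (formAtOne β g), r.sharp (formAtOne γ g)⁆) := by
  have h : ⁅r.sharp (formAtOne β g), r.sharp (formAtOne γ g)⁆ =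
      ∑ i, formAtOne γ g (finBasis ℝ _ i) •
        ⁅r.sharp (formAtOne β g), r.sharp ((finBasis ℝ _).coord i)⁆ := by
    conv_lhs => rw [dual_sum_coord (formAtOne γ g), map_sum]
    simp only [map_smul, lie_sum_smul]
  -- Expanding P♯γ on the right as well matches the derivatives of β term by term.
  rw [mlieBracket_sharpField r hγ, h, sharpField_eq_sum r γ]
  simp only [mlieBracket_sharpField_rvecField r hβ, smul_sub, Finset.sum_sub_distrib, map_sum,
    map_sub, map_smul, smul_neg, Finset.sum_neg_distrib]
  abel

/-- With D the derivative of coefficients, ⟨α, [P♯β, P♯γ]⟩ contributes r(α, Dγ(P♯β)) - r(α,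
Dβ(P♯γ)), and the terms (P♯α)(r(β, γ)) contribute the same expressions with opposite sign after
cyclic summation and skew-symmetry. -/
theorem schouten_rvecTwoVector (r : TwoVector (GroupLieAlgebra I G)) {α β γ : OneForm I G}
    (hα : SmoothForm I α) (hβ : SmoothForm I β) (hγ : SmoothForm I γ) (g : G) :
    schouten I (rvecTwoVector r) (rvecTwoVector r) α β γ g =
      -algSchouten r r (formAtOne α g) (formAtOne β g) (formAtOne γ g) := by
  have hp (a : OneForm I G) (v : GroupLieAlgebra I G) : a g (rightTr I g v) = formAtOne a g v :=
    rfl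
  simp only [schouten, algSchouten, mlieBracket_sharpField_sharpField r hα hβ,
    mlieBracket_sharpField_sharpField r hβ hγ, mlieBracket_sharpField_sharpField r hγ hα,
    dirDeriv_rvecTwoVector r hα hβ, dirDeriv_rvecTwoVector r hβ hγ,
    dirDeriv_rvecTwoVector r hγ hα, hp, map_sub, TwoVector.apply_sharp]
  have s1 := r.skew (formDeriv α g ((rvecTwoVector r).sharpField β g)) (formAtOne γ g)
  have s2 := r.skew (formDeriv α g ((rvecTwoVector r).sharpField γ g)) (formAtOne β g)
  have s3 := r.skew (formDeriv β g ((rvecTwoVector r).sharpField α g)) (formAtOne γ g)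
  have s4 := r.skew (formDeriv β g ((rvecTwoVector r).sharpField γ g)) (formAtOne α g)
  have s5 := r.skew (formDeriv γ g ((rvecTwoVector r).sharpField α g)) (formAtOne β g)
  have s6 := r.skew (formDeriv γ g ((rvecTwoVector r).sharpField β g)) (formAtOne α g)
  linarith

end Schouten

/-! ### Right-invariant Poisson-Nijenhuis structures -/

section Invariant

open VectorField Module

variable {E : Type*} [NormedAddCommGroup E] [NormedSpace ℝ E]
  {H : Type*} [TopologicalSpace H] {I : ModelWithCorners ℝ E H}
  {G : Type*} [TopologicalSpace G] [ChartedSpace H G]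

theorem dirDeriv_const (X : VectorFld I G) (c : ℝ) (g : G) : dirDeriv I X (fun _ ↦ c) g = 0 := by
  rw [dirDeriv, mfderiv_const]
  rfl

variable [Group G] [LieGroup I ∞ G] {r : TwoVector (GroupLieAlgebra I G)}
  {n : Module.End ℝ (GroupLieAlgebra I G)}

theorem formAtOne_rvecForm (ξ : Dual ℝ (GroupLieAlgebra I G)) (g : G) :
    formAtOne (rvecForm ξ) g = ξ :=
  LinearMap.ext fun v ↦ congrArg ξ (rightTrInv_rightTr g v)

theorem rvecForm_rvecField (ξ : Dual ℝ (GroupLieAlgebra I G)) (v : GroupLieAlgebra I G) (g : G) :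
    rvecForm ξ g (rvecField v g) = ξ v :=
  congrArg ξ (rightTrInv_rightTr g v)

theorem app_rvecField (v : GroupLieAlgebra I G) :
    (rvecEnd n : EndField I G).app (rvecField v) = rvecField (n v) :=
  funext fun g ↦ congrArg (fun w ↦ rightTr I g (n w)) (rightTrInv_rightTr g v)

theorem trans_rvecForm (ξ : Dual ℝ (GroupLieAlgebra I G)) :
    (rvecEnd n : EndField I G).trans (rvecForm ξ) = rvecForm (ξ ∘ₗ n) :=
  funext fun g ↦ LinearMap.ext fun w ↦ congrArg ξ (rightTrInv_rightTr g (n (rightTrInv I g w)))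

theorem rvecEnd_pow_rightTr (k : ℕ) (g : G) (v : GroupLieAlgebra I G) :
    (rvecEnd n g ^ k) (rightTr I g v) = rightTr I g ((n ^ k) v) := by
  induction k with
  | zero => rfl
  | succ k ih =>
    rw [pow_succ', pow_succ', Module.End.mul_apply, ih]
    exact congrFun (app_rvecField ((n ^ k) v)) g

variable [FiniteDimensional ℝ E]

theorem sharpField_rvecForm (ξ : Dual ℝ (GroupLieAlgebra I G)) :
    (rvecTwoVector r).sharpField (rvecForm ξ) = rvecField (r.sharp ξ) := by
  ext g
  rw [sharpField_rvecTwoVector, formAtOne_rvecForm]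
  rfl

theorem lieDeriv_rvecForm (v w : GroupLieAlgebra I G) (ξ : Dual ℝ (GroupLieAlgebra I G)) (g : G) :
    lieDeriv I (rvecField v) (rvecForm ξ) (rvecField w) g = ξ ⁅v, w⁆ := by
  simp only [lieDeriv, rvecForm_rvecField, dirDeriv_const, mlieBracket_rvecField, map_neg]
  simp

theorem isCYBESolution_of_isPoisson
    (h : IsPoisson I (rvecTwoVector r : TwoVectorField I G)) : IsCYBESolution r := by
  intro α β γ
  have hs (ξ : Dual ℝ (GroupLieAlgebra I G)) : SmoothForm I (rvecForm ξ) :=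
    smoothFormOn_rvecForm ξ _
  have := h.schouten_self _ _ _ (hs α) (hs β) (hs γ) 1
  rwa [schouten_rvecTwoVector r (hs α) (hs β) (hs γ), formAtOne_rvecForm, formAtOne_rvecForm,
    formAtOne_rvecForm, neg_eq_zero] at this

theorem isPoisson_of_isCYBESolution (h : IsCYBESolution r) :
    IsPoisson I (rvecTwoVector r : TwoVectorField I G) where
  smooth := smoothTwoVector_rvecTwoVector r
  schouten_self α β γ hα hβ hγ g := by
    rw [schouten_rvecTwoVector r hα hβ hγ, h, neg_zero]

/-- Each axiom is evaluated at 1 on invariant data. Every torsion term carries one bracket, so the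
sign of `mlieBracket_rvecField` factors out; in the concomitant it cancels against the sign in the
Lie derivative. -/
theorem isAlgPoissonNijenhuis_of_rvec
    (h : IsPoissonNijenhuis I (rvecTwoVector r) (rvecEnd n : EndField I G)) :
    IsAlgPoissonNijenhuis r n where
  cybe := isCYBESolution_of_isPoisson h.poisson
  torsion x y := by
    have := h.torsion _ _ (smoothVectorOn_rvecField x _) (smoothVectorOn_rvecField y _) 1
    have hn (v : GroupLieAlgebra I G) : rvecEnd n (1 : G) (rvecField v 1) = rvecField (n v) 1 :=
      congrFun (app_rvecField v) 1
    simp only [nijenhuisTorsion, app_rvecField, mlieBracket_rvecField, map_neg, hn] at this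
    -- Injectivity of T_e R_e suffices; it need not be identified with the identity.
    apply rightTr_injective (I := I) (1 : G)
    rw [map_zero, ← neg_eq_zero, ← this]
    simp only [map_add, map_sub, rvecField]
    abel
  comm := by
    ext β
    have := LinearMap.congr_fun (h.comm 1) (rvecForm β 1)
    apply rightTr_injective (I := I) (1 : G)
    have h1 := congrFun (sharpField_rvecForm (r := r) (I := I) β) 1
    have h2 := congrFun (sharpField_rvecForm (r := r) (I := I) (β ∘ₗ n)) 1
    have h3 := congrFun (app_rvecField (n := n) (I := I) (r.sharp β)) 1
    rw [← trans_rvecForm] at h2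
    refine h3.symm.trans (Eq.trans ?_ h2)
    rw [← sharpField_rvecForm]
    exact this
  concomitant α β z := by
    have := h.concomitant_eq (rvecForm α) (rvecForm β) (rvecField z) (smoothFormOn_rvecForm α _)
      (smoothFormOn_rvecForm β _) (smoothVectorOn_rvecField z _) 1
    have e1 (y : G) : (rvecTwoVector r y).sharp (rvecForm β y) = rvecField (r.sharp β) y :=
      congrFun (sharpField_rvecForm β) y
    have e2 (v : GroupLieAlgebra I G) (y : G) :
        rvecEnd n y (rvecField v y) = rvecField (n v) y :=
      congrFun (app_rvecField v) y
    simp only [concomitant, sharpField_rvecForm, trans_rvecForm, app_rvecField,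
      lieDeriv_rvecForm, e1, e2, rvecForm_rvecField, dirDeriv_const, LinearMap.comp_apply] at this
    simp only [map_sub]
    linarith

theorem sharp_rvecEnd_pow {s : TwoVector (GroupLieAlgebra I G)} {k : ℕ}
    (hs : s.sharp = (n ^ k) ∘ₗ r.sharp) (g : G) :
    (rvecTwoVector s g).sharp = (rvecEnd n g ^ k) ∘ₗ (rvecTwoVector r g).sharp := by
  ext β
  simp only [rvecTwoVector, TwoVector.sharp_map, LinearMap.comp_apply, rvecEnd_pow_rightTr, hs]

end Invariant

end PoissonNijenhuis

end

theorem corollary3p2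
    {E : Type*} [NormedAddCommGroup E] [NormedSpace ℝ E] [FiniteDimensional ℝ E]
    {H : Type*} [TopologicalSpace H] (I : ModelWithCorners ℝ E H) [I.Boundaryless]
    {G : Type*} [TopologicalSpace G] [ChartedSpace H G] [Group G] [LieGroup I ∞ G]
    (r : PoissonNijenhuis.TwoVector (GroupLieAlgebra I G))
    (n : Module.End ℝ (GroupLieAlgebra I G))
    (hPN : PoissonNijenhuis.IsPoissonNijenhuis I
      (PoissonNijenhuis.rvecTwoVector r) (PoissonNijenhuis.rvecEnd n))
    (k : ℕ) :
    -- the `2`-vector `r_k` exists and is unique, and so is the bivector field `Π_k`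
    (∃! rk : PoissonNijenhuis.TwoVector (GroupLieAlgebra I G), rk.sharp = (n ^ k) ∘ₗ r.sharp) ∧
    (∃! P : PoissonNijenhuis.TwoVectorField I G, ∀ g, (P g).sharp =
      (PoissonNijenhuis.rvecEnd n g ^ k) ∘ₗ (PoissonNijenhuis.rvecTwoVector r g).sharp) ∧
    ∀ rk : PoissonNijenhuis.TwoVector (GroupLieAlgebra I G), rk.sharp = (n ^ k) ∘ₗ r.sharp →
      PoissonNijenhuis.IsCYBESolution rk ∧
      ∀ P : PoissonNijenhuis.TwoVectorField I G, (∀ g, (P g).sharp =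
          (PoissonNijenhuis.rvecEnd n g ^ k) ∘ₗ (PoissonNijenhuis.rvecTwoVector r g).sharp) →
        PoissonNijenhuis.IsPoisson I P ∧ PoissonNijenhuis.IsRightInvariant P ∧
          P = PoissonNijenhuis.rvecTwoVector rk := by
  open PoissonNijenhuis in
  have hA := isAlgPoissonNijenhuis_of_rvec hPN
  have hex := TwoVector.sharp_ofSharp _ (pow_comp_sharp_skew hA.comm k)
  have huniq {P Q : TwoVectorField I G} (h : ∀ g, (P g).sharp = (Q g).sharp) : P = Q :=
    funext fun g ↦ TwoVector.sharp_injective (h g)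
  refine ⟨⟨_, hex, fun s hs ↦ TwoVector.sharp_injective (hs.trans hex.symm)⟩,
    ⟨_, sharp_rvecEnd_pow hex, fun Q hQ ↦
      huniq fun g ↦ (hQ g).trans (sharp_rvecEnd_pow hex g).symm⟩, fun s hs ↦ ?_⟩
  have hc : IsCYBESolution s := (hA.iterate lie_swap k hs).cybe
  refine ⟨hc, fun P hP ↦ ?_⟩
  obtain rfl : P = rvecTwoVector s := huniq fun g ↦ (hP g).trans (sharp_rvecEnd_pow hs g).symm
  exact ⟨isPoisson_of_isCYBESolution hc, ⟨s, rfl⟩, rfl⟩
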